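/- Let $d\ge 1$, equip $\mathbb R^d$ with the Euclidean inner product and norm, and let $\mathbb P$ be an arbitrary Borel probability measure on $\mathbb R^d$. For probability measures $\mathbb P',\mathbb P$ on $\mathbb R^d$ let $$d_W(\mathbb P',\mathbb P)=\inf_{\Pi}\int\|x-y\|\,\Pi(\mathrm dx,\mathrm dy)\in[0,\infty],$$ where the infimum is over all probability measures $\Pi$ on $\mathbb R^d\times\mathbb R^d$ with marginals $\mathbb P'$ and $\mathbb P$. For $\delta>0$ and $z\in\mathbb R^d$ define the robustified halfspace depth $$D_\delta(z\mid\mathbb P)=\inf_{u\in\mathbb R^d:\,\|u\|=1}\ \sup_{\mathbb P':\,d_W(\mathbb P',\mathbb P)\le\delta}\mathbb P'\big(\{x\in\mathbb R^d:\langle u,x-z\rangle\ge 0\}\big)\in[0,1],$$ where the supremum is over Borel probability measures $\mathbb P'$ on $\mathbb R^d$. Then: (P4) Positivity: $D_\delta(z\mid\mathbb P)>0$ for all $\delta>0$ and $z\in\mathbb R^d$. (P5) Joint continuity: the function $(z,\delta)\mapsto D_\delta(z\mid\mathbb P)$ is continuous on $\mathbb R^d\times(0,\infty)$. (P6) Level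 sets: for every $\delta>0$ and every $\alpha\in(0,1)$, either the level set $\{z\in\mathbb R^d:D_\delta(z\mid\mathbb P)=\alpha\}$ and the upper level set $\{z\in\mathbb R^d:D_\delta(z\mid\mathbb P)\ge\alpha\}$ are both non-empty and the former is the topological boundary of the latter, or both sets are empty. -/

import Mathlib

open MeasureTheory Set
open scoped ENNReal

namespace RobustDepth

/-- The set of couplings of `μ` and `ν`: the measures on the product space with first
marginal `μ` and second marginal `ν`. -/
def couplings {E : Type*} [MeasurableSpace E] (μ ν : Measure E) : Set (Measure (E × E)) :=
  {π | π.map Prod.fst = μ ∧ π.map Prod.snd = ν}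

/-- The Wasserstein (earth mover's) distance of order one, with values in `[0, ∞]`:
the infimum of `∫ ‖x - y‖ π(dx, dy)` over all couplings `π`. -/
noncomputable def wasserstein {d : ℕ} (μ ν : Measure (EuclideanSpace ℝ (Fin d))) : ℝ≥0∞ :=
  ⨅ π ∈ couplings μ ν, ∫⁻ p, ENNReal.ofReal ‖p.1 - p.2‖ ∂π

/-- The ambiguity set: all Borel probability laws within Wasserstein distance `δ` of `P`. -/
def ambiguitySet {d : ℕ} (δ : ℝ) (P : Measure (EuclideanSpace ℝ (Fin d))) :
    Set (Measure (EuclideanSpace ℝ (Fin d))) :=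
  {Q | IsProbabilityMeasure Q ∧ wasserstein Q P ≤ ENNReal.ofReal δ}

/-- The closed halfspace `{x : ⟨u, x - z⟩ ≥ 0}`. -/
def halfspace {d : ℕ} (u z : EuclideanSpace ℝ (Fin d)) : Set (EuclideanSpace ℝ (Fin d)) :=
  {x | 0 ≤ inner ℝ u (x - z)}

/-- The inner problem: the largest mass that a law in the ambiguity set gives to the closed
halfspace with direction `u` and boundary point `z`. -/
noncomputable def worstCase {d : ℕ} (δ : ℝ) (P : Measure (EuclideanSpace ℝ (Fin d)))
    (u z : EuclideanSpace ℝ (Fin d)) : ℝ≥0∞ :=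
  ⨆ Q ∈ ambiguitySet δ P, Q (halfspace u z)

/-- The robustified halfspace depth `D_δ(z | P)`: the infimum of the inner problem over all unit
vectors `u`. For `1 ≤ d` the infimum is at most one, so that `ENNReal.toReal` loses nothing. -/
noncomputable def depth {d : ℕ} (δ : ℝ) (P : Measure (EuclideanSpace ℝ (Fin d)))
    (z : EuclideanSpace ℝ (Fin d)) : ℝ :=
  (⨅ u ∈ {u : EuclideanSpace ℝ (Fin d) | ‖u‖ = 1}, worstCase δ P u z).toReal

/-- The level set `{z : D_δ(z | P) = α}`. -/
def levelSet {d : ℕ} (δ : ℝ) (P : Measure (EuclideanSpace ℝ (Fin d))) (α : ℝ) :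
    Set (EuclideanSpace ℝ (Fin d)) :=
  {z | depth δ P z = α}

/-- The upper level set `{z : D_δ(z | P) ≥ α}`. -/
def upperLevelSet {d : ℕ} (δ : ℝ) (P : Measure (EuclideanSpace ℝ (Fin d))) (α : ℝ) :
    Set (EuclideanSpace ℝ (Fin d)) :=
  {z | α ≤ depth δ P z}

end RobustDepth

namespace RobustDepth

/-! Laws near `P` are traded for transport plans onto `P`, whose cost and halfspace mass are affine.
Mixing with the free diagonal plan bounds the growth of the worst case in `δ` (`value_le_div_mul`);
translating plans trades a shift of `z` for budget (`value_le_value_add`). These bounds are uniform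
in `u`, so they survive the infimum and give joint continuity. Mixing in a plan that collapses a
large ball to `z` gives positivity. For level sets, the point is that there is no plateau below one:
once `z` is pushed along `u`, a plan either carries less mass or leaves budget to save, which the
ball plan turns into mass (`exists_value_add_smul_le`). So points of depth `α < 1` are limits of
points of smaller depth. Depth is arbitrarily small far out, and the intermediate value theorem
yields non-emptiness. -/

variable {d : ℕ} {P : Measure (EuclideanSpace ℝ (Fin d))} {δ : ℝ}
  {π : Measure (EuclideanSpace ℝ (Fin d) × EuclideanSpace ℝ (Fin d))}
  {u z : EuclideanSpace ℝ (Fin d)}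

/-- A transport plan onto `P` (the second marginal) of cost at most `δ`. -/
structure IsPlan (P : Measure (EuclideanSpace ℝ (Fin d))) (δ : ℝ)
    (π : Measure (EuclideanSpace ℝ (Fin d) × EuclideanSpace ℝ (Fin d))) : Prop where
  map_snd : π.map Prod.snd = P
  cost_le : ∫⁻ p, ENNReal.ofReal ‖p.1 - p.2‖ ∂π ≤ ENNReal.ofReal δ

/-- The mass that the first marginal of `π` gives to the halfspace. -/
noncomputable def planMass
    (π : Measure (EuclideanSpace ℝ (Fin d) × EuclideanSpace ℝ (Fin d)))
    (u z : EuclideanSpace ℝ (Fin d)) : ℝ :=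
  π.real {p | p.1 ∈ halfspace u z}

/-- The worst case probability as a real number. -/
noncomputable def value (δ : ℝ) (P : Measure (EuclideanSpace ℝ (Fin d)))
    (u z : EuclideanSpace ℝ (Fin d)) : ℝ :=
  (worstCase δ P u z).toReal

/-! ### Transport plans and their mixtures -/

lemma measurableSet_halfspace (u z : EuclideanSpace ℝ (Fin d)) :
    MeasurableSet (halfspace u z) :=
  (isClosed_le continuous_const (by fun_prop)).measurableSet

lemma measurableSet_fst_mem_halfspace (u z : EuclideanSpace ℝ (Fin d)) :
    MeasurableSet {p : EuclideanSpace ℝ (Fin d) × EuclideanSpace ℝ (Fin d) |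
      p.1 ∈ halfspace u z} :=
  measurable_fst (measurableSet_halfspace u z)

lemma measurable_cost :
    Measurable fun p : EuclideanSpace ℝ (Fin d) × EuclideanSpace ℝ (Fin d) =>
      ENNReal.ofReal ‖p.1 - p.2‖ := by
  fun_prop

lemma worstCase_le_one : worstCase δ P u z ≤ 1 :=
  iSup₂_le fun _ hQ => by
    have := hQ.1
    exact prob_le_one

lemma worstCase_ne_top : worstCase δ P u z ≠ ∞ :=
  (worstCase_le_one.trans_lt ENNReal.one_lt_top).ne

lemma planMass_nonneg : 0 ≤ planMass π u z := measureReal_nonneg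

lemma IsPlan.mono {δ' : ℝ} (h : IsPlan P δ π) (hδ : δ ≤ δ') : IsPlan P δ' π :=
  ⟨h.map_snd, h.cost_le.trans (ENNReal.ofReal_le_ofReal hδ)⟩

lemma IsPlan.isProbabilityMeasure [IsProbabilityMeasure P] (h : IsPlan P δ π) :
    IsProbabilityMeasure π := by
  have : IsProbabilityMeasure (π.map Prod.snd) := by rw [h.map_snd]; infer_instance
  exact Measure.isProbabilityMeasure_of_map Prod.snd

lemma IsPlan.real_snd_mem (h : IsPlan P δ π) {s : Set (EuclideanSpace ℝ (Fin d))}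
    (hs : MeasurableSet s) : π.real {p | p.2 ∈ s} = P.real s := by
  rw [← h.map_snd, map_measureReal_apply measurable_snd hs]
  rfl

lemma IsPlan.planMass_le_value [IsProbabilityMeasure P] (h : IsPlan P δ π) :
    planMass π u z ≤ value δ P u z := by
  have := h.isProbabilityMeasure
  have hmem : π.map Prod.fst ∈ ambiguitySet δ P :=
    ⟨Measure.isProbabilityMeasure_map measurable_fst.aemeasurable,
      (iInf₂_le π ⟨rfl, h.map_snd⟩).trans h.cost_le⟩
  have hle : (π.map Prod.fst) (halfspace u z) ≤ worstCase δ P u z :=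
    le_iSup₂ (f := fun Q (_ : Q ∈ ambiguitySet δ P) => Q (halfspace u z)) _ hmem
  rw [Measure.map_apply measurable_fst (measurableSet_halfspace u z)] at hle
  exact ENNReal.toReal_mono worstCase_ne_top hle

lemma IsPlan.map_fst {T : EuclideanSpace ℝ (Fin d) × EuclideanSpace ℝ (Fin d) →
      EuclideanSpace ℝ (Fin d)} (h : IsPlan P δ π) (hT : Measurable T) {δ' : ℝ}
    (hc : ∫⁻ p, ENNReal.ofReal ‖T p - p.2‖ ∂π ≤ ENNReal.ofReal δ') :
    IsPlan P δ' (π.map fun p => (T p, p.2)) := by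
  have hm : Measurable fun p : EuclideanSpace ℝ (Fin d) × EuclideanSpace ℝ (Fin d) =>
      (T p, p.2) := hT.prodMk measurable_snd
  refine ⟨?_, ?_⟩
  · rw [Measure.map_map measurable_snd hm]
    exact h.map_snd
  · rwa [lintegral_map measurable_cost hm]

lemma planMass_map_fst {T : EuclideanSpace ℝ (Fin d) × EuclideanSpace ℝ (Fin d) →
      EuclideanSpace ℝ (Fin d)} (hT : Measurable T) :
    planMass (π.map fun p => (T p, p.2)) u z = π.real {p | T p ∈ halfspace u z} := by
  rw [planMass, map_measureReal_apply (hT.prodMk measurable_snd)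
    (measurableSet_fst_mem_halfspace u z)]
  rfl

lemma isPlan_diagonal : IsPlan P 0 (P.map fun x => (x, x)) := by
  have hm : Measurable fun x : EuclideanSpace ℝ (Fin d) => (x, x) := by fun_prop
  refine ⟨?_, ?_⟩
  · rw [Measure.map_map measurable_snd hm]
    exact Measure.map_id
  · rw [lintegral_map measurable_cost hm]
    simp

lemma planMass_diagonal : planMass (P.map fun x => (x, x)) u z = P.real (halfspace u z) := by
  have hm : Measurable fun x : EuclideanSpace ℝ (Fin d) => (x, x) := by fun_prop
  rw [planMass, map_measureReal_apply hm (measurableSet_fst_mem_halfspace u z)]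
  rfl

lemma IsPlan.mix {π' : Measure (EuclideanSpace ℝ (Fin d) × EuclideanSpace ℝ (Fin d))}
    {δ' l : ℝ} (h : IsPlan P δ π) (h' : IsPlan P δ' π') (hδ : 0 ≤ δ) (hδ' : 0 ≤ δ')
    (hl : 0 ≤ l) (hl1 : l ≤ 1) :
    IsPlan P ((1 - l) * δ + l * δ')
      (ENNReal.ofReal (1 - l) • π + ENNReal.ofReal l • π') := by
  have hl' : 0 ≤ 1 - l := by linarith
  refine ⟨?_, ?_⟩
  · rw [Measure.map_add _ _ measurable_snd, Measure.map_smul, Measure.map_smul, h.map_snd,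
      h'.map_snd, ← add_smul, ← ENNReal.ofReal_add hl' hl]
    simp
  · rw [lintegral_add_measure, lintegral_smul_measure, lintegral_smul_measure,
      ENNReal.ofReal_add (by positivity) (by positivity), ENNReal.ofReal_mul hl',
      ENNReal.ofReal_mul hl]
    exact add_le_add (mul_le_mul_right h.cost_le _) (mul_le_mul_right h'.cost_le _)

lemma planMass_mix {π' : Measure (EuclideanSpace ℝ (Fin d) × EuclideanSpace ℝ (Fin d))}
    [IsFiniteMeasure π] [IsFiniteMeasure π'] {l : ℝ} (hl : 0 ≤ l) (hl1 : l ≤ 1) :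
    planMass (ENNReal.ofReal (1 - l) • π + ENNReal.ofReal l • π') u z =
      (1 - l) * planMass π u z + l * planMass π' u z := by
  have hl' : 0 ≤ 1 - l := by linarith
  simp only [planMass, measureReal_def, Measure.add_apply, Measure.smul_apply, smul_eq_mul]
  rw [ENNReal.toReal_add (by finiteness) (by finiteness), ENNReal.toReal_mul,
    ENNReal.toReal_mul, ENNReal.toReal_ofReal hl', ENNReal.toReal_ofReal hl]

/-- Concavity of the worst case in the budget, in the form used throughout. -/
lemma IsPlan.mix_le_value [IsProbabilityMeasure P]
    {π' : Measure (EuclideanSpace ℝ (Fin d) × EuclideanSpace ℝ (Fin d))}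
    {δ₀ δ₁ l : ℝ} (h : IsPlan P δ₀ π) (h' : IsPlan P δ₁ π') (h0 : 0 ≤ δ₀) (h1 : 0 ≤ δ₁)
    (hl : 0 ≤ l) (hl1 : l ≤ 1) (hδ : (1 - l) * δ₀ + l * δ₁ ≤ δ) :
    (1 - l) * planMass π u z + l * planMass π' u z ≤ value δ P u z := by
  have := h.isProbabilityMeasure
  have := h'.isProbabilityMeasure
  rw [← planMass_mix hl hl1]
  exact ((h.mix h' h0 h1 hl hl1).mono hδ).planMass_le_value

/-! ### Dependence of the worst case on budget and base point -/

/-- Every law in the ambiguity set is the first marginal of a plan that exceeds the budget by as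
little as desired; shrinking that plan towards the diagonal one restores the budget. -/
lemma value_le [IsProbabilityMeasure P] (hδ : 0 < δ) {c : ℝ}
    (hc : ∀ π, IsPlan P δ π → planMass π u z ≤ c) : value δ P u z ≤ c := by
  have hc0 : 0 ≤ c :=
    planMass_nonneg.trans (hc _ (isPlan_diagonal.mono hδ.le))
  refine ENNReal.toReal_le_of_le_ofReal hc0 (iSup₂_le fun Q hQ => ?_)
  obtain ⟨hQp, hQW⟩ := hQ
  rw [← ofReal_measureReal]
  refine ENNReal.ofReal_le_ofReal ?_
  have key : ∀ ε : ℝ, 0 < ε → Q.real (halfspace u z) ≤ c + ε * (c / δ) := by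
    intro ε hε
    have hlt : wasserstein Q P < ENNReal.ofReal (δ + ε) :=
      hQW.trans_lt ((ENNReal.ofReal_lt_ofReal_iff (by linarith)).2 (by linarith))
    obtain ⟨π, hπ⟩ := iInf_lt_iff.1 hlt
    obtain ⟨⟨hπ1, hπ2⟩, hcost⟩ := iInf_lt_iff.1 hπ
    have hplan : IsPlan P (δ + ε) π := ⟨hπ2, hcost.le⟩
    have hmass : planMass π u z = Q.real (halfspace u z) := by
      rw [← hπ1, map_measureReal_apply measurable_fst (measurableSet_halfspace u z)]
      rfl
    have := hplan.isProbabilityMeasure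
    have hl : 0 ≤ δ / (δ + ε) := by positivity
    have hl1 : δ / (δ + ε) ≤ 1 := (div_le_one (by linarith)).2 (by linarith)
    have hmix := isPlan_diagonal.mix hplan le_rfl (by linarith) hl hl1
    have hle := hc _ (hmix.mono (by
      rw [mul_zero, zero_add, div_mul_cancel₀ _ (by linarith)]))
    have : IsProbabilityMeasure (P.map fun x => (x, x)) :=
      (isPlan_diagonal (P := P)).isProbabilityMeasure
    rw [planMass_mix hl hl1, hmass] at hle
    have h2 : δ / (δ + ε) * Q.real (halfspace u z) ≤ c := by
      have : 0 ≤ (1 - δ / (δ + ε)) * planMass (P.map fun x => (x, x)) u z :=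
        mul_nonneg (by linarith) planMass_nonneg
      linarith
    rw [div_mul_eq_mul_div, div_le_iff₀ (by linarith)] at h2
    have h3 : c + ε * (c / δ) = c * (δ + ε) / δ := by field_simp
    rw [h3, le_div_iff₀ hδ]
    linarith
  refine le_of_forall_pos_le_add fun η hη => ?_
  -- The `+ 1` covers `c = 0`.
  have hpos : 0 < η / (c / δ + 1) := by positivity
  refine (key _ hpos).trans ?_
  have : η / (c / δ + 1) * (c / δ) ≤ η := by
    rw [div_mul_eq_mul_div, div_le_iff₀ (by positivity)]
    nlinarith
  linarith

lemma value_mono [IsProbabilityMeasure P] {δ' : ℝ} (hδ : 0 < δ) (h : δ ≤ δ') :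
    value δ P u z ≤ value δ' P u z :=
  value_le hδ fun _ hπ => (hπ.mono h).planMass_le_value

/-- A plan of cost `δ'`, given weight `δ / δ'` against the free diagonal plan, costs at most `δ`. -/
lemma value_le_div_mul [IsProbabilityMeasure P] {δ' : ℝ} (hδ : 0 < δ) (h : δ ≤ δ') :
    value δ' P u z ≤ δ' / δ * value δ P u z := by
  have hδ' : 0 < δ' := hδ.trans_le h
  refine value_le hδ' fun π hπ => ?_
  have hle := isPlan_diagonal.mix_le_value (δ := δ) (u := u) (z := z) hπ le_rfl hδ'.le
    (l := δ / δ') (by positivity) ((div_le_one hδ').2 h)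
    (by rw [mul_zero, zero_add, div_mul_cancel₀ _ hδ'.ne'])
  have h0 : 0 ≤ (1 - δ / δ') * planMass (P.map fun x => (x, x)) u z :=
    mul_nonneg (sub_nonneg.2 ((div_le_one hδ').2 h)) planMass_nonneg
  have h1 : δ / δ' * planMass π u z ≤ value δ P u z := by linarith
  rw [div_mul_eq_mul_div, div_le_iff₀ hδ'] at h1
  rw [div_mul_eq_mul_div, le_div_iff₀ hδ]
  linarith

/-- Translating the first coordinate of a plan by `w` carries one halfspace onto the other at extra
cost at most `‖w‖`. -/
lemma value_le_value_add [IsProbabilityMeasure P] (hδ : 0 < δ)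
    (w : EuclideanSpace ℝ (Fin d)) : value δ P u z ≤ value (δ + ‖w‖) P u (z + w) := by
  refine value_le hδ fun π hπ => ?_
  have := hπ.isProbabilityMeasure
  have hT : Measurable fun p : EuclideanSpace ℝ (Fin d) × EuclideanSpace ℝ (Fin d) =>
      p.1 + w := by fun_prop
  have hplan : IsPlan P (δ + ‖w‖) (π.map fun p => (p.1 + w, p.2)) := by
    refine hπ.map_fst hT ?_
    calc ∫⁻ p, ENNReal.ofReal ‖p.1 + w - p.2‖ ∂π
        ≤ ∫⁻ p, (ENNReal.ofReal ‖p.1 - p.2‖ + ENNReal.ofReal ‖w‖) ∂π := by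
          refine lintegral_mono fun p => ?_
          rw [← ENNReal.ofReal_add (norm_nonneg _) (norm_nonneg _)]
          refine ENNReal.ofReal_le_ofReal ?_
          rw [add_sub_right_comm]
          exact norm_add_le _ _
      _ = (∫⁻ p, ENNReal.ofReal ‖p.1 - p.2‖ ∂π) + ENNReal.ofReal ‖w‖ := by
          rw [lintegral_add_left measurable_cost]
          simp
      _ ≤ ENNReal.ofReal (δ + ‖w‖) := by
          rw [ENNReal.ofReal_add hδ.le (norm_nonneg _)]
          exact add_le_add hπ.cost_le le_rfl
  refine le_trans (le_of_eq ?_) hplan.planMass_le_value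
  rw [planMass_map_fst hT]
  simp [planMass, halfspace]

lemma value_le_mul_value [IsProbabilityMeasure P] (hδ : 0 < δ)
    (z' : EuclideanSpace ℝ (Fin d)) :
    value δ P u z ≤ (δ + ‖z' - z‖) / δ * value δ P u z' := by
  have h := value_le_value_add (P := P) (u := u) (z := z) hδ (z' - z)
  rw [add_sub_cancel] at h
  exact h.trans (value_le_div_mul hδ (by linarith [norm_nonneg (z' - z)]))

/-! ### Strict decrease and decay along a direction -/

/-- Moving a closed ball to its centre. -/
lemma exists_isPlan_closedBall [IsProbabilityMeasure P] (u z : EuclideanSpace ℝ (Fin d))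
    {R : ℝ} (hR : 0 ≤ R) :
    ∃ π, IsPlan P R π ∧ P.real (Metric.closedBall z R) ≤ planMass π u z := by
  classical
  let T : EuclideanSpace ℝ (Fin d) × EuclideanSpace ℝ (Fin d) → EuclideanSpace ℝ (Fin d) :=
    fun p => if p.2 ∈ Metric.closedBall z R then z else p.2
  have hT : Measurable T :=
    Measurable.ite (measurable_snd Metric.isClosed_closedBall.measurableSet)
      measurable_const measurable_snd
  have hd := isPlan_diagonal (P := P)
  have := hd.isProbabilityMeasure
  refine ⟨_, hd.map_fst hT (δ' := R) ?_, ?_⟩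
  · calc ∫⁻ p, ENNReal.ofReal ‖T p - p.2‖ ∂(P.map fun x => (x, x))
        ≤ ∫⁻ _, ENNReal.ofReal R ∂(P.map fun x => (x, x)) := by
          refine lintegral_mono fun p => ENNReal.ofReal_le_ofReal ?_
          simp only [T]
          split_ifs with h
          · rwa [mem_closedBall_iff_norm, norm_sub_rev] at h
          · simpa using hR
      _ = ENNReal.ofReal R := by simp
  · rw [planMass_map_fst hT, ← hd.real_snd_mem Metric.isClosed_closedBall.measurableSet]
    refine measureReal_mono fun p hp => ?_
    have : T p = z := if_pos hp
    simp [this, halfspace]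

/-- The bound `r ≤ R` serves, with `r = δ`, to make `δ / R` a mixing weight. -/
lemma exists_closedBall_measureReal_gt [IsProbabilityMeasure P]
    (z : EuclideanSpace ℝ (Fin d)) {b : ℝ} (hb : b < 1) (r : ℝ) :
    ∃ R, r ≤ R ∧ b < P.real (Metric.closedBall z R) := by
  have hmono : Monotone fun n : ℕ => Metric.closedBall z (n : ℝ) := fun m n h =>
    Metric.closedBall_subset_closedBall (by exact_mod_cast h)
  have ht := tendsto_measure_iUnion_atTop (μ := P) hmono
  rw [Metric.iUnion_closedBall_nat, measure_univ] at ht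
  have ht' := (ENNReal.tendsto_toReal ENNReal.one_ne_top).comp ht
  obtain ⟨n, hn, hr⟩ := ((ht'.eventually (lt_mem_nhds (by simpa using hb))).and
    (Filter.eventually_ge_atTop ⌈r⌉₊)).exists
  exact ⟨n, (Nat.le_ceil r).trans (by exact_mod_cast hr), hn⟩

/-- A plan for the halfspace through `z + t • u` yields one for the halfspace through `z` by
transporting orthogonally to the boundary; every moved point saves at least `t`. -/
lemma IsPlan.exists_projection [IsProbabilityMeasure P] (h : IsPlan P δ π) (hδ : 0 ≤ δ)
    (hu : ‖u‖ = 1) {t : ℝ} (ht : 0 ≤ t) :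
    ∃ m, 0 ≤ m ∧ t * m ≤ δ ∧ planMass π u (z + t • u) ≤ P.real (halfspace u z) + m ∧
      ∃ π', IsPlan P (δ - t * m) π' ∧ planMass π u (z + t • u) ≤ planMass π' u z := by
  classical
  have := h.isProbabilityMeasure
  have huu : inner ℝ u u = 1 := by rw [real_inner_self_eq_norm_sq, hu]; norm_num
  have hshift : ∀ y : EuclideanSpace ℝ (Fin d),
      y ∈ halfspace u (z + t • u) ↔ t ≤ inner ℝ u (y - z) := by
    intro y
    simp only [halfspace, mem_ofPred_eq, ← sub_sub]
    rw [inner_sub_right _ _ (t • u), inner_smul_right, huu, mul_one, sub_nonneg]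
  let A : Set (EuclideanSpace ℝ (Fin d) × EuclideanSpace ℝ (Fin d)) :=
    {p | p.1 ∈ halfspace u (z + t • u) ∧ p.2 ∉ halfspace u z}
  have hA : MeasurableSet A :=
    (measurableSet_fst_mem_halfspace u (z + t • u)).inter
      (measurable_snd (measurableSet_halfspace u z)).compl
  let T : EuclideanSpace ℝ (Fin d) × EuclideanSpace ℝ (Fin d) → EuclideanSpace ℝ (Fin d) :=
    fun p => if p ∈ A then p.2 - (inner ℝ u (p.2 - z) : ℝ) • u else p.2
  have hT : Measurable T := Measurable.ite hA (by fun_prop) measurable_snd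
  have hpt : ∀ p, ENNReal.ofReal ‖T p - p.2‖ + A.indicator (fun _ => ENNReal.ofReal t) p ≤
      ENNReal.ofReal ‖p.1 - p.2‖ := by
    intro p
    by_cases hp : p ∈ A
    · have h1 : t ≤ inner ℝ u (p.1 - z) := (hshift _).1 hp.1
      have h2 : inner ℝ u (p.2 - z) < 0 := not_le.1 hp.2
      have h3 : inner ℝ u (p.1 - z) - inner ℝ u (p.2 - z) ≤ ‖p.1 - p.2‖ := by
        rw [← inner_sub_right, sub_sub_sub_cancel_right]
        simpa [hu] using real_inner_le_norm u (p.1 - p.2)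
      have h4 : ‖T p - p.2‖ = -inner ℝ u (p.2 - z) := by
        have : T p = p.2 - (inner ℝ u (p.2 - z) : ℝ) • u := if_pos hp
        rw [this, sub_sub_cancel_left, norm_neg, norm_smul, hu, mul_one, Real.norm_eq_abs,
          abs_of_neg h2]
      rw [indicator_of_mem hp, ← ENNReal.ofReal_add (norm_nonneg _) ht, h4]
      exact ENNReal.ofReal_le_ofReal (by linarith)
    · have : T p = p.2 := if_neg hp
      simp [this, hp]
  have hcost : (∫⁻ p, ENNReal.ofReal ‖T p - p.2‖ ∂π) + ENNReal.ofReal (t * π.real A) ≤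
      ENNReal.ofReal δ := by
    refine le_trans (le_of_eq ?_) ((lintegral_mono hpt).trans h.cost_le)
    rw [lintegral_add_right _ (measurable_const.indicator hA), lintegral_indicator_const hA,
      ENNReal.ofReal_mul ht, ofReal_measureReal]
  have htm : t * π.real A ≤ δ :=
    (ENNReal.ofReal_le_ofReal_iff hδ).1 (le_add_self.trans hcost)
  refine ⟨π.real A, measureReal_nonneg, htm, ?_, _, h.map_fst hT ?_, ?_⟩
  · rw [← h.real_snd_mem (measurableSet_halfspace u z)]
    refine (measureReal_mono fun p hp => ?_).trans (measureReal_union_le _ _)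
    by_cases h2 : p.2 ∈ halfspace u z
    · exact Or.inl h2
    · exact Or.inr ⟨hp, h2⟩
  · rw [ENNReal.ofReal_sub _ (mul_nonneg ht measureReal_nonneg)]
    exact ENNReal.le_sub_of_add_le_right ENNReal.ofReal_ne_top hcost
  · rw [planMass_map_fst hT]
    refine measureReal_mono fun p hp => ?_
    by_cases h2 : p.2 ∈ halfspace u z
    · have : T p = p.2 := if_neg fun hA => hA.2 h2
      simpa [this] using h2
    · have : T p = p.2 - (inner ℝ u (p.2 - z) : ℝ) • u := if_pos ⟨hp, h2⟩
      simp only [mem_ofPred_eq, this, halfspace]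
      rw [sub_right_comm, inner_sub_right, inner_smul_right, huu, mul_one, sub_self]

/-- Below level one the worst case probability decreases strictly along `u`, uniformly in `u`. -/
lemma exists_value_add_smul_le [IsProbabilityMeasure P] (hδ : 0 < δ)
    (z : EuclideanSpace ℝ (Fin d)) {a t : ℝ} (ha : a < 1) (ht : 0 < t) :
    ∃ c, 0 < c ∧ ∀ u : EuclideanSpace ℝ (Fin d), ‖u‖ = 1 → value δ P u z ≤ a →
      value δ P u (z + t • u) ≤ value δ P u z - c := by
  obtain ⟨R, hR, hball⟩ :=
    exists_closedBall_measureReal_gt (P := P) z (b := (1 + a) / 2) (by linarith) δ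
  have hR0 : 0 < R := hδ.trans_le hR
  -- `k` is the least advantage of the ball plan over any mass at most `a`.
  set k : ℝ := (1 - a) / 2 with hk
  have hk0 : 0 < k := by rw [hk]; linarith
  have hl1 : δ / R ≤ 1 := (div_le_one hR0).2 hR
  set c₀ : ℝ := δ / R * k with hc₀
  have hc₀0 : 0 < c₀ := by positivity
  refine ⟨min (c₀ / 2) (t * (c₀ / 2) / R * k), by positivity, fun u hu hv => ?_⟩
  obtain ⟨πb, hπb, hmb⟩ := exists_isPlan_closedBall (P := P) u z hR0.le
  have hmb' : a + k ≤ planMass πb u z := by rw [hk]; linarith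
  have hP : P.real (halfspace u z) + c₀ ≤ value δ P u z := by
    have h1 := isPlan_diagonal.mix_le_value (δ := δ) (u := u) (z := z) hπb le_rfl hR0.le
      (l := δ / R) (by positivity) hl1
      (by rw [mul_zero, zero_add, div_mul_cancel₀ _ hR0.ne'])
    have h2 := (isPlan_diagonal.mono hδ.le).planMass_le_value (P := P) (u := u) (z := z)
    rw [planMass_diagonal] at h1 h2
    have h3 : δ / R * k ≤ δ / R * (planMass πb u z - P.real (halfspace u z)) :=
      mul_le_mul_of_nonneg_left (by linarith) (by positivity)
    rw [hc₀]
    linarith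
  refine value_le hδ fun π hπ => ?_
  obtain ⟨m, hm0, htm, hq, π', hπ', hqq⟩ := hπ.exists_projection (z := z) hδ.le hu ht.le
  -- If `m` is small, the mass is at most `P(H) + c₀ / 2`, and `P(H)` is `c₀` below the value.
  -- Otherwise the projected plan saves at least `t * (c₀ / 2)`, which pays for weight `l` on the
  -- ball plan and gains `l * k`.
  rcases le_or_gt m (c₀ / 2) with hm | hm
  · have := min_le_left (c₀ / 2) (t * (c₀ / 2) / R * k)
    linarith
  · have := min_le_right (c₀ / 2) (t * (c₀ / 2) / R * k)
    have htc : t * (c₀ / 2) ≤ t * m := mul_le_mul_of_nonneg_left hm.le ht.le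
    set l : ℝ := t * (c₀ / 2) / R with hl
    have hl0 : 0 ≤ l := by positivity
    have hl1 : l ≤ 1 := (div_le_one hR0).2 (by linarith)
    have hlR : l * R = t * (c₀ / 2) := div_mul_cancel₀ _ hR0.ne'
    have h1 := hπ'.mix_le_value (δ := δ) (u := u) (z := z) hπb (by linarith) hR0.le hl0 hl1
      (by nlinarith [mul_nonneg hl0 (sub_nonneg.2 htm)])
    have h2 := (hπ'.mono (by nlinarith : δ - t * m ≤ δ)).planMass_le_value (u := u) (z := z)
    have h3 : l * k ≤ l * (planMass πb u z - planMass π' u z) :=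
      mul_le_mul_of_nonneg_left (by linarith) hl0
    linarith

/-- Mass in the far halfspace either starts outside the ball or travels at least `M`; Markov's
inequality bounds the latter. -/
lemma value_smul_le [IsProbabilityMeasure P] (hδ : 0 < δ) (hu : ‖u‖ = 1) {R M : ℝ}
    (hM : 0 < M) :
    value δ P u ((R + M) • u) ≤ 1 - P.real (Metric.closedBall 0 R) + δ / M := by
  refine value_le hδ fun π hπ => ?_
  have := hπ.isProbabilityMeasure
  have huu : inner ℝ u u = 1 := by rw [real_inner_self_eq_norm_sq, hu]; norm_num
  have hsub : {p : EuclideanSpace ℝ (Fin d) × EuclideanSpace ℝ (Fin d) |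
      p.1 ∈ halfspace u ((R + M) • u)} ⊆
      {p | p.2 ∈ (Metric.closedBall (0 : EuclideanSpace ℝ (Fin d)) R)ᶜ} ∪
        {p | ENNReal.ofReal M ≤ ENNReal.ofReal ‖p.1 - p.2‖} := by
    intro p hp
    by_cases h2 : p.2 ∈ Metric.closedBall (0 : EuclideanSpace ℝ (Fin d)) R
    · refine Or.inr (ENNReal.ofReal_le_ofReal ?_)
      have h1 : R + M ≤ inner ℝ u p.1 := by
        have : 0 ≤ inner ℝ u (p.1 - (R + M) • u) := hp
        rw [inner_sub_right, inner_smul_right, huu] at this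
        linarith
      have h3 : inner ℝ u p.2 ≤ R := by
        have := real_inner_le_norm u p.2
        rw [hu, one_mul] at this
        exact this.trans (by simpa using h2)
      have h4 := real_inner_le_norm u (p.1 - p.2)
      rw [hu, one_mul, inner_sub_right] at h4
      linarith
    · exact Or.inl h2
  have hmarkov : π.real {p | ENNReal.ofReal M ≤ ENNReal.ofReal ‖p.1 - p.2‖} ≤ δ / M := by
    refine ENNReal.toReal_le_of_le_ofReal (by positivity) ?_
    rw [ENNReal.ofReal_div_of_pos hM]
    exact (meas_ge_le_lintegral_div measurable_cost.aemeasurable (by simpa using hM)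
      ENNReal.ofReal_ne_top).trans (ENNReal.div_le_div_right hπ.cost_le _)
  refine (measureReal_mono hsub).trans ((measureReal_union_le _ _).trans ?_)
  rw [hπ.real_snd_mem Metric.isClosed_closedBall.measurableSet.compl,
    probReal_compl_eq_one_sub Metric.isClosed_closedBall.measurableSet]
  linarith

/-! ### The infimum over directions: positivity and continuity -/

lemma depth_le_value (hu : ‖u‖ = 1) : depth δ P z ≤ value δ P u z :=
  ENNReal.toReal_mono worstCase_ne_top (iInf₂_le u hu)

lemma exists_norm_eq_one (hd : 1 ≤ d) : ∃ u : EuclideanSpace ℝ (Fin d), ‖u‖ = 1 :=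
  ⟨EuclideanSpace.single ⟨0, hd⟩ 1, by simp⟩

/-- `1 ≤ d` matters: an empty infimum would be `∞`, which `toReal` sends to `0`. -/
lemma le_depth (hd : 1 ≤ d) {c : ℝ}
    (h : ∀ u : EuclideanSpace ℝ (Fin d), ‖u‖ = 1 → c ≤ value δ P u z) :
    c ≤ depth δ P z := by
  obtain ⟨u₀, hu₀⟩ := exists_norm_eq_one hd
  refine (ENNReal.ofReal_le_iff_le_toReal
    (ne_top_of_le_ne_top (worstCase_ne_top (u := u₀)) (iInf₂_le u₀ hu₀))).1 ?_
  exact le_iInf₂ fun u hu => ENNReal.ofReal_le_of_le_toReal (h u hu)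

lemma exists_value_lt (hd : 1 ≤ d) {c : ℝ} (h : depth δ P z < c) :
    ∃ u : EuclideanSpace ℝ (Fin d), ‖u‖ = 1 ∧ value δ P u z < c := by
  by_contra! hc
  exact h.not_ge (le_depth hd hc)

lemma depth_pos [IsProbabilityMeasure P] (hd : 1 ≤ d) (hδ : 0 < δ)
    (z : EuclideanSpace ℝ (Fin d)) : 0 < depth δ P z := by
  obtain ⟨R, hR, hball⟩ := exists_closedBall_measureReal_gt (P := P) z zero_lt_one δ
  have hR0 : 0 < R := hδ.trans_le hR
  have hpos : 0 < δ / R * P.real (Metric.closedBall z R) := by positivity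
  refine hpos.trans_le (le_depth hd fun u _ => ?_)
  obtain ⟨πb, hπb, hmb⟩ := exists_isPlan_closedBall (P := P) u z hR0.le
  have hl1 : δ / R ≤ 1 := (div_le_one hR0).2 hR
  have h1 := isPlan_diagonal.mix_le_value (δ := δ) (u := u) (z := z) hπb le_rfl hR0.le
    (l := δ / R) (by positivity) hl1
    (by rw [mul_zero, zero_add, div_mul_cancel₀ _ hR0.ne'])
  have h2 : 0 ≤ (1 - δ / R) * planMass (P.map fun x => (x, x)) u z :=
    mul_nonneg (by linarith) planMass_nonneg
  have h3 : δ / R * P.real (Metric.closedBall z R) ≤ δ / R * planMass πb u z :=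
    mul_le_mul_of_nonneg_left hmb (by positivity)
  linarith

/-- A multiplicative modulus of continuity of the depth in both variables. -/
lemma depth_le_mul_depth [IsProbabilityMeasure P] (hd : 1 ≤ d) {δ' : ℝ} (hδ : 0 < δ)
    (hδ' : 0 < δ') (z z' : EuclideanSpace ℝ (Fin d)) :
    depth δ P z ≤ (δ' + ‖z' - z‖) / δ' * (max δ δ' / δ' * depth δ' P z') := by
  have hmax : 0 < max δ δ' := lt_max_of_lt_left hδ
  have hk : 0 < (δ' + ‖z' - z‖) / δ' * (max δ δ' / δ') := by positivity
  rw [← mul_assoc, ← div_le_iff₀' hk]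
  refine le_depth hd fun u hu => ?_
  rw [div_le_iff₀' hk]
  calc depth δ P z ≤ value δ P u z := depth_le_value hu
    _ ≤ value (max δ δ') P u z := value_mono hδ (le_max_left _ _)
    _ ≤ max δ δ' / δ' * value δ' P u z := value_le_div_mul hδ' (le_max_right _ _)
    _ ≤ max δ δ' / δ' * ((δ' + ‖z' - z‖) / δ' * value δ' P u z') := by
        gcongr
        exact value_le_mul_value hδ' z'
    _ = _ := by ring

lemma continuousOn_depth [IsProbabilityMeasure P] (hd : 1 ≤ d) :
    ContinuousOn (fun p : EuclideanSpace ℝ (Fin d) × ℝ => depth p.2 P p.1)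
      (univ ×ˢ Ioi (0 : ℝ)) := by
  rintro ⟨z, δ⟩ ⟨-, hδ : 0 < δ⟩
  refine ContinuousAt.continuousWithinAt ?_
  have hpos : ∀ᶠ p : EuclideanSpace ℝ (Fin d) × ℝ in nhds (z, δ), 0 < p.2 :=
    continuousAt_snd.eventually (lt_mem_nhds hδ)
  have hz : ContinuousAt (fun p : EuclideanSpace ℝ (Fin d) × ℝ => ‖p.1 - z‖) (z, δ) := by
    fun_prop
  have hz' : ContinuousAt (fun p : EuclideanSpace ℝ (Fin d) × ℝ => ‖z - p.1‖) (z, δ) := by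
    fun_prop
  have hs : ContinuousAt (fun p : EuclideanSpace ℝ (Fin d) × ℝ => p.2) (z, δ) :=
    continuousAt_snd
  have hup : Filter.Tendsto (fun p : EuclideanSpace ℝ (Fin d) × ℝ =>
      (δ + ‖z - p.1‖) / δ * (max p.2 δ / δ * depth δ P z)) (nhds (z, δ))
      (nhds (depth δ P z)) := by
    have : ContinuousAt (fun p : EuclideanSpace ℝ (Fin d) × ℝ =>
      (δ + ‖z - p.1‖) / δ * (max p.2 δ / δ * depth δ P z)) (z, δ) := by fun_prop
    convert this.tendsto using 2
    simp [hδ.ne']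
  have hlow : Filter.Tendsto (fun p : EuclideanSpace ℝ (Fin d) × ℝ =>
      depth δ P z / ((p.2 + ‖p.1 - z‖) / p.2 * (max δ p.2 / p.2))) (nhds (z, δ))
      (nhds (depth δ P z)) := by
    have : ContinuousAt (fun p : EuclideanSpace ℝ (Fin d) × ℝ =>
        depth δ P z / ((p.2 + ‖p.1 - z‖) / p.2 * (max δ p.2 / p.2))) (z, δ) := by
      have hden : ContinuousAt (fun p : EuclideanSpace ℝ (Fin d) × ℝ =>
          (p.2 + ‖p.1 - z‖) / p.2 * (max δ p.2 / p.2)) (z, δ) :=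
        ((hs.add hz).div hs hδ.ne').mul ((continuousAt_const.max hs).div hs hδ.ne')
      exact continuousAt_const.div hden (by simp [hδ.ne'])
    convert this.tendsto using 2
    simp [hδ.ne']
  refine tendsto_of_tendsto_of_tendsto_of_le_of_le' hlow hup ?_ ?_
  · filter_upwards [hpos] with p hp
    have hk : 0 < (p.2 + ‖p.1 - z‖) / p.2 * (max δ p.2 / p.2) := by
      have : 0 < max δ p.2 := lt_max_of_lt_left hδ
      positivity
    rw [div_le_iff₀' hk, mul_assoc]
    exact depth_le_mul_depth hd hδ hp z p.1
  · filter_upwards [hpos] with p hp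
    exact depth_le_mul_depth hd hp hδ p.1 z

lemma continuous_depth [IsProbabilityMeasure P] (hd : 1 ≤ d) (hδ : 0 < δ) :
    Continuous fun z => depth δ P z :=
  (continuousOn_depth hd).comp_continuous (f := fun z => (z, δ)) (by fun_prop)
    fun _ => ⟨mem_univ _, hδ⟩

/-! ### Level sets -/

lemma exists_depth_lt [IsProbabilityMeasure P] (hd : 1 ≤ d) (hδ : 0 < δ) {a : ℝ} (ha : 0 < a) :
    ∃ z, depth δ P z < a := by
  obtain ⟨u, hu⟩ := exists_norm_eq_one hd
  obtain ⟨R, -, hR⟩ := exists_closedBall_measureReal_gt (P := P) 0 (b := 1 - a / 2)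
    (by linarith) 0
  -- The tail of `P` is below `a / 2`, and `M = 2 * δ / a` makes the Markov term equal to `a / 2`.
  refine ⟨(R + 2 * δ / a) • u, (depth_le_value hu).trans_lt
    ((value_smul_le hδ hu (by positivity)).trans_lt ?_)⟩
  have : δ / (2 * δ / a) = a / 2 := by field_simp
  rw [this]
  linarith

lemma levelSet_eq_frontier [IsProbabilityMeasure P] (hd : 1 ≤ d) (hδ : 0 < δ) {a : ℝ}
    (ha : a < 1) : levelSet δ P a = frontier (upperLevelSet δ P a) := by
  have hcont := continuous_depth (P := P) hd hδ
  refine Subset.antisymm (fun z hz => ?_) fun z hz => ?_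
  · have hz' : depth δ P z = a := hz
    rw [frontier_eq_closure_inter_closure]
    refine ⟨subset_closure hz'.ge, Metric.mem_closure_iff.2 fun ε hε => ?_⟩
    obtain ⟨c, hc, hdec⟩ := exists_value_add_smul_le (P := P) hδ z (a := (1 + a) / 2)
      (by linarith) (half_pos hε)
    -- A near-minimal direction suffices: within `c` of `a`, so that the decrease lands below `a`,
    -- and at most `(1 + a) / 2`, so that the decrease applies.
    obtain ⟨u, hu, hv⟩ := exists_value_lt (P := P) (δ := δ) (z := z) hd
      (c := a + min c ((1 - a) / 2))
      (by rw [hz']; linarith [lt_min hc (show 0 < (1 - a) / 2 by linarith)])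
    have h1 := min_le_left c ((1 - a) / 2)
    have h2 := min_le_right c ((1 - a) / 2)
    have hlt : depth δ P (z + (ε / 2) • u) < a :=
      (depth_le_value hu).trans_lt ((hdec u hu (by linarith)).trans_lt (by linarith))
    refine ⟨z + (ε / 2) • u, fun h => hlt.not_ge h, ?_⟩
    rw [dist_self_add_right, norm_smul, hu, mul_one, Real.norm_eq_abs,
      abs_of_pos (half_pos hε)]
    linarith
  · exact (frontier_le_subset_eq continuous_const hcont hz).symm

lemma levelSet_nonempty [IsProbabilityMeasure P] (hd : 1 ≤ d) (hδ : 0 < δ) {a : ℝ}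
    (ha : 0 < a) (h : (upperLevelSet δ P a).Nonempty) : (levelSet δ P a).Nonempty := by
  obtain ⟨z, hz⟩ := h
  obtain ⟨z', hz'⟩ := exists_depth_lt (P := P) hd hδ ha
  exact mem_range_of_exists_le_of_exists_ge (continuous_depth hd hδ) ⟨z', hz'.le⟩ ⟨z, hz⟩

end RobustDepth

theorem mainTheorem4 (d : ℕ) (hd : 1 ≤ d) (P : Measure (EuclideanSpace ℝ (Fin d)))
    [IsProbabilityMeasure P] :
    (∀ δ : ℝ, 0 < δ → ∀ z : EuclideanSpace ℝ (Fin d), 0 < RobustDepth.depth δ P z) ∧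
    ContinuousOn (fun p : EuclideanSpace ℝ (Fin d) × ℝ => RobustDepth.depth p.2 P p.1)
      (univ ×ˢ Ioi (0 : ℝ)) ∧
    (∀ δ : ℝ, 0 < δ → ∀ α ∈ Ioo (0 : ℝ) 1,
      ((RobustDepth.levelSet δ P α).Nonempty ∧ (RobustDepth.upperLevelSet δ P α).Nonempty ∧
        RobustDepth.levelSet δ P α = frontier (RobustDepth.upperLevelSet δ P α)) ∨
      (RobustDepth.levelSet δ P α = ∅ ∧ RobustDepth.upperLevelSet δ P α = ∅)) := by
  refine ⟨fun δ hδ z => RobustDepth.depth_pos hd hδ z, RobustDepth.continuousOn_depth hd,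
    fun δ hδ α hα => ?_⟩
  rcases (RobustDepth.upperLevelSet δ P α).eq_empty_or_nonempty with h | h
  · refine Or.inr ⟨subset_eq_empty (fun z hz => ?_) h, h⟩
    exact (show RobustDepth.depth δ P z = α from hz).ge
  · exact Or.inl ⟨RobustDepth.levelSet_nonempty hd hδ hα.1 h, h,
      RobustDepth.levelSet_eq_frontier hd hδ hα.2⟩
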